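/- **Model.** There are $n$ candidates, each with a pair of non-negative valuations $(\rho,\xi)$, where $\rho$ is the receiver's and $\xi$ the sender's value if the candidate is hired. An instance is a multiset of $n$ such pairs. The candidates arrive in uniformly random order over rounds $1,\dots,n$. A (direct, possibly randomized) mechanism $\phi$ sends in each round $t$ a signal in $\{\mathrm{HIRE},\mathrm{NOT}\}$, based on the valuation pairs that have arrived in rounds $1,\dots,t$ and on its own earlier signals. After each signal the receiver decides irrevocably whether to hire the current candidate; the process ends with the first hire, and both players get $0$ if nobody is hired. The receiver knows $\phi$ and the instance, and observes the signals; *with disclosure* she also observes the pairs of the rejected candidates of all earlier rounds. She has cardinal utility, i.e. maximizes the expected value of $\rho$ of the hired candidate. The mechanism is *persuasive for an instance* if in every round, given everything she has observed after obeying all earlier signals, obeying all signals from then on (hire exactly upon HIRE) maximizes her conditional expected utility among all her continuation strategies (ties allowed). In the *secretary scenario* the sender does not know the instance, so a mechanism is called *persuasive* there if it is persuasive for every instance with $n$ candidates. The sender's *success probability* is the probability that, under obedience, the hired candidate has the largest $\xi$-value of the instance; her *expected utility* is the expected $\xi$-value of the hired candidate. In the *benchmark* (basic scenario without disclosure) the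 sender knows the instance; $\mathrm{OPT}$ of an instance is the supremum, over all mechanisms persuasive for that instance without disclosure, of the success probability (ordinal sender), respectively of the expected utility (cardinal sender). **Theorem.** (1) For every $n\ge 1$ there is an instance with $n$ candidates and $\mathrm{OPT}>0$ (in both senses) on which every mechanism that is persuasive in the secretary scenario with disclosure has success probability at most $\frac2n\cdot\mathrm{OPT}$ (ordinal $\mathrm{OPT}$) and expected sender utility at most $\frac2n\cdot\mathrm{OPT}$ (cardinal $\mathrm{OPT}$). In particular, no persuasive mechanism guarantees the sender more than $\frac2n\cdot\mathrm{OPT}$, in either sense. (2) More precisely, for $n\ge2$ let instance I consist of $a=(\rho,\xi)=(0,1)$, $b=(1,0)$ and $n-2$ copies of $c=(\tfrac12,0)$, and let instance II consist of $a=(0,1)$ and $n-1$ copies of $c=(\tfrac12,0)$. For instance I, $\mathrm{OPT}=\tfrac12$ in both senses, and it is attained; the mechanism that always signals HIRE (so that the receiver hires in round 1) has success probability and expected utility exactly $\frac1n$ on instance I. Every mechanism that is persuasive with disclosure for both instances I and II has, on instance I, success probability at most $\frac2n\cdot\mathrm{OPT}$ and expected utility at most $\frac2n\cdot\mathrm{OPT}$,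 and thus neither value exceeds that of hiring in round 1. -/

import Mathlib

open scoped NNReal

namespace OnlinePersuasion

noncomputable section

/-- A candidate is what the sender observes on arrival: the pair `(ρ, ξ)` of non-negative
valuations, the first for the receiver and the second for the sender. -/
abbrev Candidate := ℝ≥0 × ℝ≥0

/-- The receiver's value of a candidate. -/
def rho (c : Candidate) : ℝ := c.1

/-- The sender's value of a candidate. -/
def xi (c : Candidate) : ℝ := c.2

/-- An instance with `n` candidates: a family (multiset) of `n` valuation pairs. -/
abbrev Instance (n : ℕ) := Fin n → Candidate

/-- A (randomized) direct signaling strategy for `n` rounds. In round `t` the sender has seen the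
candidates of rounds `≤ t` and remembers her own signals of rounds `< t`; `hireProb` is the
conditional probability that the signal of round `t` is HIRE. -/
structure Mechanism (n : ℕ) where
  hireProb : (t : Fin n) → (Set.Iic t → Candidate) → (Set.Iio t → Bool) → unitInterval

/-- The probability that `φ` emits the signals `s` (`true` is HIRE, `false` is NOT) when the
candidates arrive in the sequence `x`. -/
def signalProb {n : ℕ} (φ : Mechanism n) (x : Fin n → Candidate) (s : Fin n → Bool) : ℝ :=
  ∏ t : Fin n,
    if s t = true then (φ.hireProb t (fun i => x i) (fun i => s i) : ℝ)
    else 1 - (φ.hireProb t (fun i => x i) (fun i => s i) : ℝ)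

/-- Expectation of `f (arrival sequence) (signals)` when the candidates of `θ` arrive in uniformly
random order and the sender uses `φ`. -/
def expect {n : ℕ} (φ : Mechanism n) (θ : Instance n)
    (f : (Fin n → Candidate) → (Fin n → Bool) → ℝ) : ℝ :=
  (∑ π : Equiv.Perm (Fin n), ∑ s : Fin n → Bool,
      signalProb φ (θ ∘ π) s * f (θ ∘ π) s) / (Nat.factorial n : ℝ)

open Classical in
/-- The payoff `u (x r)` where `r` is the first round `≥ start` in which the decision `d` is to
hire, and `0` if there is no such round. -/
def payoff {n : ℕ} (u : Candidate → ℝ) (start : ℕ) (d : Fin n → Bool) (x : Fin n → Candidate) :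
    ℝ :=
  ∑ r : Fin n,
    if start ≤ (r : ℕ) ∧ d r = true ∧ ∀ q : Fin n, start ≤ (q : ℕ) → q < r → d q = false
    then u (x r) else 0

/-- A receiver strategy with disclosure: the decision in round `t` (`true` means hire) depends on
the rejected candidates of rounds `< t` and on the signals of rounds `≤ t`. -/
abbrev DisclosureStrategy (n : ℕ) :=
  (t : Fin n) → (Set.Iio t → Candidate) → (Set.Iic t → Bool) → Bool

/-- A receiver strategy without disclosure: the decision in round `t` depends only on the signals
of rounds `≤ t`. -/
abbrev NoDisclosureStrategy (n : ℕ) :=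
  (t : Fin n) → (Set.Iic t → Bool) → Bool

open Classical in
/-- `φ` is persuasive for the instance `θ` (known to the receiver) in the scenario with disclosure:
in every round `t` that an obedient receiver can reach (all earlier signals were NOT), given the
disclosed candidates `y` of the earlier rounds and the current signal `b`, no continuation strategy
`τ` gives the receiver a larger expected utility than obeying all signals from round `t` on.
Both sides are conditional expectations multiplied by the probability of the information set. -/
def PersuasiveDisclosure {n : ℕ} (φ : Mechanism n) (θ : Instance n) : Prop :=
  ∀ (t : Fin n) (y : Fin n → Candidate) (b : Bool) (τ : DisclosureStrategy n),
    expect φ θ (fun x s =>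
        if (∀ i, i < t → x i = y i ∧ s i = false) ∧ s t = b
        then payoff rho t (fun r => τ r (fun i => x i) (fun i => s i)) x else 0) ≤
      expect φ θ (fun x s =>
        if (∀ i, i < t → x i = y i ∧ s i = false) ∧ s t = b
        then payoff rho t s x else 0)

open Classical in
/-- `φ` is persuasive for the instance `θ` in the scenario without disclosure: the same condition,
where the receiver observes only the signals. -/
def PersuasiveNoDisclosure {n : ℕ} (φ : Mechanism n) (θ : Instance n) : Prop :=
  ∀ (t : Fin n) (b : Bool) (τ : NoDisclosureStrategy n),
    expect φ θ (fun x s =>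
        if (∀ i, i < t → s i = false) ∧ s t = b
        then payoff rho t (fun r => τ r (fun i => s i)) x else 0) ≤
      expect φ θ (fun x s =>
        if (∀ i, i < t → s i = false) ∧ s t = b
        then payoff rho t s x else 0)

/-- Persuasive in the secretary scenario with disclosure: the sender does not know the valuation
pairs, so one and the same mechanism has to be persuasive whatever the instance is. -/
def SecretaryPersuasive {n : ℕ} (φ : Mechanism n) : Prop :=
  ∀ θ : Instance n, PersuasiveDisclosure φ θ

/-- The sender's expected utility from `φ` on `θ` when the receiver is obedient. -/
def senderUtility {n : ℕ} (φ : Mechanism n) (θ : Instance n) : ℝ :=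
  expect φ θ (fun x s => payoff xi 0 s x)

open Classical in
/-- The sender's success probability: the probability that, under an obedient receiver, the hired
candidate has the largest sender value in `θ`. -/
def successProb {n : ℕ} (φ : Mechanism n) (θ : Instance n) : ℝ :=
  expect φ θ (fun x s => payoff (fun c => if ∀ j, xi (θ j) ≤ xi c then 1 else 0) 0 s x)

/-- The success probabilities achievable in the benchmark (basic scenario without disclosure), where
the sender knows `θ` and the mechanism only has to be persuasive for `θ`. -/
def benchmarkSuccesses {n : ℕ} (θ : Instance n) : Set ℝ :=
  {v | ∃ φ : Mechanism n, PersuasiveNoDisclosure φ θ ∧ v = successProb φ θ}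

/-- The expected sender utilities achievable in the benchmark. -/
def benchmarkUtilities {n : ℕ} (θ : Instance n) : Set ℝ :=
  {v | ∃ φ : Mechanism n, PersuasiveNoDisclosure φ θ ∧ v = senderUtility φ θ}

/-- `OPT` for ordinal sender utility. -/
def optSuccess {n : ℕ} (θ : Instance n) : ℝ := sSup (benchmarkSuccesses θ)

/-- `OPT` for cardinal sender utility. -/
def optUtility {n : ℕ} (θ : Instance n) : ℝ := sSup (benchmarkUtilities θ)

/-- Instance I: one candidate `a = (0, 1)`, one `b = (1, 0)`, and `n - 2` copies of
`c = (1/2, 0)`. -/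
def instanceI (n : ℕ) : Instance n := fun i =>
  if (i : ℕ) = 0 then (0, 1) else if (i : ℕ) = 1 then (1, 0) else (1 / 2, 0)

/-- Instance II: one candidate `a = (0, 1)` and `n - 1` copies of `c = (1/2, 0)`. -/
def instanceII (n : ℕ) : Instance n := fun i =>
  if (i : ℕ) = 0 then (0, 1) else (1 / 2, 0)

/-- The mechanism that always signals HIRE, so that an obedient receiver hires in round 1. -/
def hireFirst (n : ℕ) : Mechanism n := ⟨fun _ _ _ => 1⟩

end

end OnlinePersuasion

open OnlinePersuasion

/-! Write h(x) for the probability that the first HIRE comes in round t when x arrives there after a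
fixed prefix (`hireAt`). By `hireAt_congr` it does not depend on later arrivals. An obedient
receiver could ignore HIRE in round t and hire in a later round t' instead. Averaging this deviation
over the exchange of the two arrivals gives `sum_exchange_nonneg`: the sum of (h(u) - h(v))(ρ(u) -
ρ(v)) over the pairs u, v in rounds t, t' is nonnegative.

If b has been rejected, only a and c remain in instance I, so h(a) ≤ h(c). If only copies of c have
been rejected, instance II gives h(a) ≤ h(c), and instance I, averaged over exchanging a and b,
gives h(a) ≤ h(b). Hence before the last round, a is never hired more readily than another candidate
in its place (`hireAt_le_of_agree`). Exchanging rounds t and n bounds the probability of hiring a in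
round t by that of hiring in round t while a is last. Summed over t this is at most 1/n.

In the benchmark the receiver can secure the average value 1/2 by hiring at once, and ρ + ξ ≤ 1, so
the sender gets at most 1/2. Hiring the first of a and b attains this: signals alone cannot tell a
from b. -/

namespace OnlinePersuasion

noncomputable section

/-! ### Signal probabilities -/

/-- The conditional probability of the signal `s t` of round `t`, given the earlier signals. -/
def signalFactor {n : ℕ} (φ : Mechanism n) (x : Fin n → Candidate) (s : Fin n → Bool)
    (t : Fin n) : ℝ :=
  if s t = true then (φ.hireProb t (fun i => x i) (fun i => s i) : ℝ)
  else 1 - (φ.hireProb t (fun i => x i) (fun i => s i) : ℝ)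

theorem signalFactor_nonneg {n : ℕ} (φ : Mechanism n) (x : Fin n → Candidate) (s : Fin n → Bool)
    (t : Fin n) : 0 ≤ signalFactor φ x s t := by
  unfold signalFactor
  split_ifs
  · exact unitInterval.nonneg _
  · exact unitInterval.one_minus_nonneg _

theorem signalProb_eq_prod {n : ℕ} (φ : Mechanism n) (x : Fin n → Candidate) (s : Fin n → Bool) :
    signalProb φ x s = ∏ t, signalFactor φ x s t := rfl

theorem signalProb_nonneg {n : ℕ} (φ : Mechanism n) (x : Fin n → Candidate) (s : Fin n → Bool) :
    0 ≤ signalProb φ x s :=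
  Finset.prod_nonneg fun t _ => signalFactor_nonneg φ x s t

theorem signalFactor_congr {n : ℕ} (φ : Mechanism n) {x x' : Fin n → Candidate}
    {s s' : Fin n → Bool} {t : Fin n} (hx : ∀ i ≤ t, x i = x' i) (hs : ∀ i ≤ t, s i = s' i) :
    signalFactor φ x s t = signalFactor φ x' s' t := by
  have h1 : (fun i : Set.Iic t => x i) = fun i : Set.Iic t => x' i := funext fun i => hx i i.2
  have h2 : (fun i : Set.Iio t => s i) = fun i : Set.Iio t => s' i :=
    funext fun i => hs i (le_of_lt i.2)
  simp only [signalFactor, h1, h2, hs t le_rfl]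

theorem signalFactor_update_add {n : ℕ} (φ : Mechanism n) (x : Fin n → Candidate)
    (s : Fin n → Bool) (t : Fin n) :
    signalFactor φ x (Function.update s t true) t +
      signalFactor φ x (Function.update s t false) t = 1 := by
  have h (b : Bool) : (fun i : Set.Iio t => Function.update s t b i) = fun i : Set.Iio t => s i :=
    funext fun i => Function.update_of_ne (ne_of_lt i.2) _ _
  simp [signalFactor, h]

/-- The probability that the signals of the first `k` rounds are those of `s₀`. -/
theorem sum_signalProb_prefix {n : ℕ} (φ : Mechanism n) (x : Fin n → Candidate) (m : ℕ) :
    ∀ (k : ℕ) (s₀ : Fin n → Bool), k + m = n →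
    (∑ s : Fin n → Bool, if ∀ i : Fin n, (i : ℕ) < k → s i = s₀ i then signalProb φ x s else 0) =
      ∏ i : Fin n, if (i : ℕ) < k then signalFactor φ x s₀ i else 1 := by
  induction m with
  | zero =>
    intro k s₀ hk
    obtain rfl : k = n := by omega
    have h (s : Fin k → Bool) : (∀ i : Fin k, (i : ℕ) < k → s i = s₀ i) ↔ s = s₀ := by
      simp [funext_iff]
    simp only [h]
    simp [signalProb_eq_prod]
  | succ m ih =>
    intro k s₀ hk
    let κ : Fin n := ⟨k, by omega⟩
    -- The induction is on the number of free rounds; the first of them, κ, is split by its signal.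
    have hsplit (s : Fin n → Bool) :
        (if ∀ i : Fin n, (i : ℕ) < k → s i = s₀ i then signalProb φ x s else 0) =
        (if ∀ i : Fin n, (i : ℕ) < k + 1 → s i = Function.update s₀ κ true i
          then signalProb φ x s else 0) +
        (if ∀ i : Fin n, (i : ℕ) < k + 1 → s i = Function.update s₀ κ false i
          then signalProb φ x s else 0) := by
      have h (b : Bool) : (∀ i : Fin n, (i : ℕ) < k + 1 → s i = Function.update s₀ κ b i) ↔
          (∀ i : Fin n, (i : ℕ) < k → s i = s₀ i) ∧ s κ = b := by
        constructor
        · intro h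
          refine ⟨fun i hi => ?_, by simpa using h κ (by simp [κ])⟩
          have hne : i ≠ κ := fun e => by simp [e, κ] at hi
          simpa [hne] using h i (by omega)
        · rintro ⟨h, hb⟩ i hi
          by_cases e : i = κ
          · simp [e, hb]
          · have : (i : ℕ) ≠ k := fun h' => e (Fin.ext h')
            simpa [e] using h i (by omega)
      simp only [h]
      by_cases hp : ∀ i : Fin n, (i : ℕ) < k → s i = s₀ i <;> cases hb : s κ <;> simp [hp]
    have hprod (b : Bool) :
        (∏ i : Fin n, if (i : ℕ) < k + 1 then signalFactor φ x (Function.update s₀ κ b) i else 1) =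
        (∏ i : Fin n, if (i : ℕ) < k then signalFactor φ x s₀ i else 1) *
          signalFactor φ x (Function.update s₀ κ b) κ := by
      have h (i : Fin n) :
          (if (i : ℕ) < k + 1 then signalFactor φ x (Function.update s₀ κ b) i else 1) =
          (if (i : ℕ) < k then signalFactor φ x s₀ i else 1) *
            (if i = κ then signalFactor φ x (Function.update s₀ κ b) κ else 1) := by
        by_cases e : i = κ
        · simp [e, κ]
        · have hne : (i : ℕ) ≠ k := fun h' => e (Fin.ext h')
          by_cases hi : (i : ℕ) < k
          · have hc : signalFactor φ x (Function.update s₀ κ b) i = signalFactor φ x s₀ i :=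
              signalFactor_congr φ (fun _ _ => rfl) fun j hj => Function.update_of_ne (fun e' => by
                have : (j : ℕ) ≤ i := hj
                simp [e', κ] at this; omega) _ _
            simp [e, hi, hc, Nat.lt_succ_of_lt hi]
          · have : ¬ (i : ℕ) < k + 1 := by omega
            simp [e, hi, this]
      simp only [h, Finset.prod_mul_distrib, Finset.prod_ite_eq', Finset.mem_univ, if_true]
    simp only [hsplit, Finset.sum_add_distrib]
    rw [ih (k + 1) _ (by omega), ih (k + 1) _ (by omega), hprod, hprod, ← mul_add,
      signalFactor_update_add, mul_one]

theorem sum_signalProb {n : ℕ} (φ : Mechanism n) (x : Fin n → Candidate) :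
    ∑ s, signalProb φ x s = 1 := by
  simpa using sum_signalProb_prefix φ x n 0 (fun _ => false) (by simp)

open Classical in
/-- The probability that the first HIRE signal is sent in round `t`. -/
def hireAt {n : ℕ} (φ : Mechanism n) (x : Fin n → Candidate) (t : Fin n) : ℝ :=
  ∑ s : Fin n → Bool, if (∀ i, i < t → s i = false) ∧ s t = true then signalProb φ x s else 0

/-- Signals after round t sum out, and those up to t see only arrivals up to t. This makes exchanges
with later rounds, and comparisons across instances, possible. -/
theorem hireAt_congr {n : ℕ} (φ : Mechanism n) {x x' : Fin n → Candidate} {t : Fin n}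
    (h : ∀ i ≤ t, x i = x' i) : hireAt φ x t = hireAt φ x' t := by
  have key (x : Fin n → Candidate) : hireAt φ x t =
      ∏ i : Fin n, if (i : ℕ) < t + 1 then signalFactor φ x (fun i => decide (i = t)) i else 1 := by
    rw [← sum_signalProb_prefix φ x (n - (t + 1)) (t + 1) _ (by omega), hireAt]
    refine Finset.sum_congr rfl fun s _ => if_congr ?_ rfl rfl
    constructor
    · rintro ⟨h1, h2⟩ i hi
      rcases lt_or_eq_of_le (show i ≤ t from Nat.lt_succ_iff.mp hi) with hlt | rfl
      · simp [h1 i hlt, hlt.ne]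
      · simp [h2]
    · intro h
      exact ⟨fun i hi => by simpa [hi.ne] using h i (Nat.lt_succ_of_lt hi),
        by simpa using h t (Nat.lt_succ_self _)⟩
  rw [key, key]
  refine Finset.prod_congr rfl fun i _ => ?_
  split_ifs with hi
  · exact signalFactor_congr φ (fun j hj => h j (hj.trans (Nat.lt_succ_iff.mp hi))) fun _ _ => rfl
  · rfl

/-! ### Payoffs and expectations -/

theorem payoff_eq_of_first {n : ℕ} (u : Candidate → ℝ) {start : ℕ} {d : Fin n → Bool}
    (x : Fin n → Candidate) {r : Fin n} (hr : start ≤ (r : ℕ)) (hd : d r = true)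
    (hq : ∀ q : Fin n, start ≤ (q : ℕ) → q < r → d q = false) :
    payoff u start d x = u (x r) := by
  rw [payoff, Finset.sum_eq_single r]
  · rw [if_pos ⟨hr, hd, hq⟩]
  · rintro q - hne
    rw [if_neg]
    rintro ⟨h1, h2, h3⟩
    rcases lt_or_gt_of_ne hne with h | h
    · simp [hq q h1 h] at h2
    · simp [h3 r hr h] at hd
  · simp

theorem exists_first_or_forall_false {n : ℕ} (start : ℕ) (d : Fin n → Bool) :
    (∃ r : Fin n, start ≤ (r : ℕ) ∧ d r = true ∧
      ∀ q : Fin n, start ≤ (q : ℕ) → q < r → d q = false) ∨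
    ∀ r : Fin n, start ≤ (r : ℕ) → d r = false := by
  by_cases h : ∃ r : Fin n, start ≤ (r : ℕ) ∧ d r = true
  · left
    obtain ⟨r, ⟨h1, h2⟩, hmin⟩ := WellFounded.has_min (wellFounded_lt (α := Fin n))
      {r : Fin n | start ≤ (r : ℕ) ∧ d r = true} h
    exact ⟨r, h1, h2, fun q hq hlt => by
      by_contra hne
      exact hmin q ⟨hq, by simpa using hne⟩ hlt⟩
  · right
    intro r hr
    by_contra hne
    exact h ⟨r, hr, by simpa using hne⟩

theorem payoff_eq_zero {n : ℕ} (u : Candidate → ℝ) {start : ℕ} {d : Fin n → Bool}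
    (x : Fin n → Candidate) (h : ∀ r : Fin n, start ≤ (r : ℕ) → d r = false) :
    payoff u start d x = 0 :=
  Finset.sum_eq_zero fun r _ => if_neg fun ⟨h1, h2, _⟩ => by simp [h r h1] at h2

theorem payoff_congr {n : ℕ} {u u' : Candidate → ℝ} (start : ℕ) (d : Fin n → Bool)
    {x : Fin n → Candidate} (h : ∀ r, u (x r) = u' (x r)) :
    payoff u start d x = payoff u' start d x := by
  simp only [payoff, h]

/-- Equal decisions stop in the same round, so a roundwise bound passes to the payoffs. It is
applied to ρ and ξ on one arrival order, and to ρ on two orders. -/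
theorem payoff_add_payoff_le_one {n : ℕ} {u v : Candidate → ℝ} (start : ℕ) (d : Fin n → Bool)
    {x y : Fin n → Candidate} (h : ∀ r, u (x r) + v (y r) ≤ 1) :
    payoff u start d x + payoff v start d y ≤ 1 := by
  rcases exists_first_or_forall_false start d with ⟨r, h1, h2, h3⟩ | h0
  · rw [payoff_eq_of_first u x h1 h2 h3, payoff_eq_of_first v y h1 h2 h3]
    exact h r
  · simp [payoff_eq_zero _ _ h0]

theorem expect_mono {n : ℕ} (φ : Mechanism n) (θ : Instance n)
    {f g : (Fin n → Candidate) → (Fin n → Bool) → ℝ}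
    (h : ∀ (π : Equiv.Perm (Fin n)) (s : Fin n → Bool), f (θ ∘ π) s ≤ g (θ ∘ π) s) :
    expect φ θ f ≤ expect φ θ g := by
  unfold expect
  gcongr with π _ s _
  · exact signalProb_nonneg _ _ _
  · exact h π s

theorem expect_add {n : ℕ} (φ : Mechanism n) (θ : Instance n)
    (f g : (Fin n → Candidate) → (Fin n → Bool) → ℝ) :
    expect φ θ (fun x s => f x s + g x s) = expect φ θ f + expect φ θ g := by
  simp only [expect, mul_add, Finset.sum_add_distrib, add_div]

theorem expect_of_forall_eq {n : ℕ} (φ : Mechanism n) (θ : Instance n)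
    (f : (Fin n → Candidate) → ℝ) :
    expect φ θ (fun x _ => f x) = (∑ π : Equiv.Perm (Fin n), f (θ ∘ π)) / (n.factorial : ℝ) := by
  simp only [expect, ← Finset.sum_mul, sum_signalProb, one_mul]

theorem sum_perm_one (n : ℕ) : ∑ _π : Equiv.Perm (Fin n), (1 : ℝ) = n.factorial := by
  simp [Fintype.card_perm]

theorem expect_one {n : ℕ} (φ : Mechanism n) (θ : Instance n) :
    expect φ θ (fun _ _ => 1) = 1 := by
  rw [expect_of_forall_eq φ θ fun _ => 1, sum_perm_one, div_self (by positivity)]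

/-- The sum is the same for every round, so it equals its average over rounds. -/
theorem sum_perm_apply {n : ℕ} (g : Fin n → ℝ) (t : Fin n) :
    (∑ π : Equiv.Perm (Fin n), g (π t)) / (n.factorial : ℝ) = (∑ i, g i) / n := by
  have hconst (t' : Fin n) : ∑ π : Equiv.Perm (Fin n), g (π t') =
      ∑ π : Equiv.Perm (Fin n), g (π t) := by
    rw [← Equiv.sum_comp (Equiv.mulRight (Equiv.swap t t'))]
    simp
  have h : (n : ℝ) * ∑ π : Equiv.Perm (Fin n), g (π t) = n.factorial * ∑ i, g i := by
    calc (n : ℝ) * ∑ π : Equiv.Perm (Fin n), g (π t)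
        = ∑ t' : Fin n, ∑ π : Equiv.Perm (Fin n), g (π t') := by simp [hconst]
      _ = ∑ π : Equiv.Perm (Fin n), ∑ t' : Fin n, g (π t') := Finset.sum_comm
      _ = ∑ _π : Equiv.Perm (Fin n), ∑ i, g i :=
          Finset.sum_congr rfl fun π _ => Equiv.sum_comp π g
      _ = _ := by simp [Fintype.card_perm]
  have hn : (n : ℝ) ≠ 0 := by
    have := t.pos
    positivity
  field_simp
  linarith

theorem sum_hireAt_le_one {n : ℕ} (φ : Mechanism n) (x : Fin n → Candidate) :
    ∑ t, hireAt φ x t ≤ 1 := by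
  simp only [hireAt]
  rw [Finset.sum_comm, ← sum_signalProb φ x]
  refine Finset.sum_le_sum fun s _ => ?_
  have h := payoff_add_payoff_le_one (u := fun _ => 1) (v := fun _ => 0) 0 s (x := x) (y := x)
    (by simp)
  have h0 : payoff (fun _ => 0) 0 s x = 0 := by simp [payoff]
  have h1 : (∑ t, if (∀ i, i < t → s i = false) ∧ s t = true then signalProb φ x s else 0) =
      signalProb φ x s * payoff (fun _ => 1) 0 s x := by
    rw [payoff, Finset.mul_sum]
    refine Finset.sum_congr rfl fun t _ => ?_
    simp [and_comm]
  rw [h1]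
  exact mul_le_of_le_one_right (signalProb_nonneg _ _ _) (by linarith)

theorem expect_payoff_eq_sum_hireAt {n : ℕ} (φ : Mechanism n) (θ : Instance n)
    (u : Candidate → ℝ) :
    expect φ θ (fun x s => payoff u 0 s x) =
      (∑ t, ∑ π : Equiv.Perm (Fin n), hireAt φ (θ ∘ π) t * u (θ (π t))) / (n.factorial : ℝ) := by
  rw [expect, Finset.sum_comm (s := (Finset.univ : Finset (Fin n)))]
  congr 1
  refine Finset.sum_congr rfl fun π _ => ?_
  simp only [payoff, hireAt, Finset.mul_sum, Finset.sum_mul]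
  rw [Finset.sum_comm]
  refine Finset.sum_congr rfl fun t _ => Finset.sum_congr rfl fun s _ => ?_
  simp [and_comm]

/-! ### The exchange inequality -/

open Classical in
/-- Persuasiveness against the deviation "ignore HIRE in round `t` and hire in round `t'`",
symmetrized over the exchange of the candidates of rounds `t` and `t'`. -/
theorem PersuasiveDisclosure.sum_exchange_nonneg {n : ℕ} {φ : Mechanism n} {θ : Instance n}
    (h : PersuasiveDisclosure φ θ) (y : Fin n → Candidate) {t t' : Fin n} (htt : t < t') :
    0 ≤ ∑ π : Equiv.Perm (Fin n),
      if ∀ i, i < t → θ (π i) = y i then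
        (hireAt φ (Function.update y t (θ (π t))) t - hireAt φ (Function.update y t (θ (π t'))) t) *
          (rho (θ (π t)) - rho (θ (π t')))
      else 0 := by
  have hmarg (x : Fin n → Candidate) (w : ℝ) :
      (∑ s, signalProb φ x s *
        if (∀ i, i < t → x i = y i ∧ s i = false) ∧ s t = true then w else 0) =
      if ∀ i, i < t → x i = y i then hireAt φ (Function.update y t (x t)) t * w else 0 := by
    split_ifs with hx
    · rw [← hireAt_congr φ (x := x), hireAt, Finset.sum_mul]
      · refine Finset.sum_congr rfl fun s _ => ?_
        have : (∀ i, i < t → x i = y i ∧ s i = false) ↔ ∀ i, i < t → s i = false :=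
          ⟨fun h i hi => (h i hi).2, fun h i hi => ⟨hx i hi, h i hi⟩⟩
        simp [this]
      · intro i hi
        rcases lt_or_eq_of_le hi with hlt | rfl
        · rw [Function.update_of_ne hlt.ne, hx i hlt]
        · simp
    · refine Finset.sum_eq_zero fun s _ => ?_
      rw [if_neg, mul_zero]
      rintro ⟨h1, -⟩
      exact hx fun i hi => (h1 i hi).1
  -- The deviation hires in round t' and in no other round.
  have h1 := h t y true fun r _ _ => decide (r = t')
  have hL (x : Fin n → Candidate) :
      payoff rho t (fun r => decide (r = t')) x = rho (x t') :=
    payoff_eq_of_first rho x htt.le (by simp) fun q _ hq => by simp [hq.ne]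
  have hR (x : Fin n → Candidate) (s : Fin n → Bool) :
      (if (∀ i, i < t → x i = y i ∧ s i = false) ∧ s t = true then payoff rho t s x else 0) =
      if (∀ i, i < t → x i = y i ∧ s i = false) ∧ s t = true then rho (x t) else 0 := by
    split_ifs with hc
    · exact payoff_eq_of_first rho x le_rfl hc.2 fun q hq hq' => absurd hq' (not_lt.mpr hq)
    · rfl
  simp only [hL, hR, expect, hmarg] at h1
  rw [div_le_div_iff_of_pos_right (by positivity)] at h1
  set F : Equiv.Perm (Fin n) → ℝ := fun π =>
    if ∀ i, i < t → θ (π i) = y i then hireAt φ (Function.update y t (θ (π t))) t *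
      (rho (θ (π t)) - rho (θ (π t'))) else 0 with hF
  have h2 : 0 ≤ ∑ π, F π := by
    have : ∑ π, F π = (∑ π : Equiv.Perm (Fin n), if ∀ i, i < t → θ (π i) = y i then
        hireAt φ (Function.update y t (θ (π t))) t * rho (θ (π t)) else 0) -
        ∑ π : Equiv.Perm (Fin n), if ∀ i, i < t → θ (π i) = y i then
        hireAt φ (Function.update y t (θ (π t))) t * rho (θ (π t')) else 0 := by
      rw [← Finset.sum_sub_distrib]
      refine Finset.sum_congr rfl fun π _ => ?_
      simp only [hF]
      split_ifs <;> ring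
    rw [this]
    exact sub_nonneg.mpr h1
  -- Multiplying on the right permutes rounds: t and t' swap, the prefix before t stays.
  have h3 : 0 ≤ ∑ π, F (Equiv.mulRight (Equiv.swap t t') π) := by
    rwa [Equiv.sum_comp (Equiv.mulRight (Equiv.swap t t')) F]
  have h4 := add_nonneg h2 h3
  rw [← Finset.sum_add_distrib] at h4
  refine h4.trans_eq (Finset.sum_congr rfl fun π _ => ?_)
  have hpre : (∀ i, i < t → θ ((Equiv.mulRight (Equiv.swap t t') π) i) = y i) ↔
      ∀ i, i < t → θ (π i) = y i := by
    refine forall₂_congr fun i hi => ?_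
    simp [Equiv.swap_apply_of_ne_of_ne hi.ne (hi.trans htt).ne]
  simp only [hF, hpre]
  split_ifs
  · simp
    ring
  · simp

/-- If only the candidates `u` and `v` can still arrive in rounds `t` and `t'`, then the one that
the receiver likes less is not hired in round `t` with a larger probability than the other. -/
theorem PersuasiveDisclosure.hireAt_le_of_two_values {n : ℕ} {φ : Mechanism n} {θ : Instance n}
    (h : PersuasiveDisclosure φ θ) {y : Fin n → Candidate} {t t' : Fin n} (htt : t < t')
    {u v : Candidate} (huv : rho u < rho v)
    (hval : ∀ π : Equiv.Perm (Fin n), (∀ i, i < t → θ (π i) = y i) →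
      ∀ r, t ≤ r → θ (π r) = u ∨ θ (π r) = v)
    {π₀ : Equiv.Perm (Fin n)} (hy : ∀ i, i < t → θ (π₀ i) = y i) (hu : θ (π₀ t) = u)
    (hv : θ (π₀ t') = v) :
    hireAt φ (Function.update y t u) t ≤ hireAt φ (Function.update y t v) t := by
  classical
  by_contra! hlt
  have hsum := h.sum_exchange_nonneg y htt
  refine absurd hsum (not_le.mpr ?_)
  refine (Finset.sum_lt_sum (g := fun _ => (0 : ℝ)) (fun π _ => ?_)
    ⟨π₀, Finset.mem_univ _, ?_⟩).trans_eq Finset.sum_const_zero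
  -- Were h(u) > h(v), every pair of values would contribute at most 0, and the pair at `π₀`
  -- strictly less.
  · split_ifs with hm
    · rcases hval π hm t le_rfl with h1 | h1 <;> rcases hval π hm t' htt.le with h2 | h2 <;>
        simp only [h1, h2] <;> nlinarith
    · exact le_rfl
  · rw [if_pos hy, hu, hv]
    nlinarith

/-! ### Values in instances I and II -/

theorem instanceI_zero {n : ℕ} {i : Fin n} (h : (i : ℕ) = 0) : instanceI n i = (0, 1) := by
  simp [instanceI, h]

theorem instanceI_one {n : ℕ} {i : Fin n} (h : (i : ℕ) = 1) : instanceI n i = (1, 0) := by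
  simp [instanceI, h]

theorem instanceI_other {n : ℕ} {i : Fin n} (h0 : (i : ℕ) ≠ 0) (h1 : (i : ℕ) ≠ 1) :
    instanceI n i = (1 / 2, 0) := by
  simp [instanceI, h0, h1]

theorem instanceII_zero {n : ℕ} {i : Fin n} (h : (i : ℕ) = 0) : instanceII n i = (0, 1) := by
  simp [instanceII, h]

theorem instanceII_other {n : ℕ} {i : Fin n} (h0 : (i : ℕ) ≠ 0) :
    instanceII n i = (1 / 2, 0) := by
  simp [instanceII, h0]

@[simp] theorem rho_mk (p q : ℝ≥0) : rho (p, q) = p := rfl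

@[simp] theorem xi_mk (p q : ℝ≥0) : xi (p, q) = q := rfl

theorem rho_instanceI {n : ℕ} (i : Fin n) :
    rho (instanceI n i) = if (i : ℕ) = 0 then 0 else if (i : ℕ) = 1 then 1 else 1 / 2 := by
  unfold instanceI
  split_ifs <;> simp

theorem xi_instanceI {n : ℕ} (i : Fin n) :
    xi (instanceI n i) = if (i : ℕ) = 0 then 1 else 0 := by
  unfold instanceI
  split_ifs <;> simp

theorem instanceI_eq_b_iff {n : ℕ} {i : Fin n} : instanceI n i = (1, 0) ↔ (i : ℕ) = 1 := by
  refine ⟨fun h => ?_, instanceI_one⟩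
  have := congrArg rho h
  rw [rho_instanceI] at this
  by_contra h1
  split_ifs at this <;> norm_num at this

theorem instanceI_eq_c_iff {n : ℕ} {i : Fin n} :
    instanceI n i = (1 / 2, 0) ↔ (i : ℕ) ≠ 0 ∧ (i : ℕ) ≠ 1 := by
  refine ⟨fun h => ?_, fun h => instanceI_other h.1 h.2⟩
  have := congrArg rho h
  rw [rho_instanceI] at this
  constructor <;> intro h1 <;> simp [h1] at this

/-- The permutation that exchanges the candidates `a` and `b` of instance I. -/
def swapAB {n : ℕ} (hn : 1 < n) : Equiv.Perm (Fin n) :=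
  Equiv.swap ⟨0, by omega⟩ ⟨1, hn⟩

theorem swapAB_zero {n : ℕ} (hn : 1 < n) {i : Fin n} (hi : (i : ℕ) = 0) :
    (swapAB hn i : ℕ) = 1 := by
  rw [show i = ⟨0, by omega⟩ from Fin.ext hi]
  simp [swapAB]

theorem swapAB_one {n : ℕ} (hn : 1 < n) {i : Fin n} (hi : (i : ℕ) = 1) :
    (swapAB hn i : ℕ) = 0 := by
  rw [show i = ⟨1, hn⟩ from Fin.ext hi]
  simp [swapAB]

theorem swapAB_other {n : ℕ} (hn : 1 < n) {i : Fin n} (hi0 : (i : ℕ) ≠ 0) (hi1 : (i : ℕ) ≠ 1) :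
    swapAB hn i = i :=
  Equiv.swap_apply_of_ne_of_ne (fun e => hi0 (by simp [e])) fun e => hi1 (by simp [e])

/-! ### Candidate a is never favoured -/

/-- After rejected copies of `c` in instance I, `a` is not hired with a larger probability
than `b`. -/
theorem hireAt_a_le_hireAt_b {n : ℕ} {φ : Mechanism n} (h : PersuasiveDisclosure φ (instanceI n))
    {y : Fin n → Candidate} {t t' : Fin n} (htt : t < t') (hc : ∀ i, i < t → y i = (1 / 2, 0))
    {π₀ : Equiv.Perm (Fin n)} (hy : ∀ i, i < t → instanceI n (π₀ i) = y i)
    (h0 : (π₀ t : ℕ) = 0) :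
    hireAt φ (Function.update y t (0, 1)) t ≤ hireAt φ (Function.update y t (1, 0)) t := by
  classical
  have hn : 1 < n := by omega
  set sw := swapAB hn
  by_contra! hlt
  have hsum := h.sum_exchange_nonneg y htt
  set F : Equiv.Perm (Fin n) → ℝ := fun π =>
    if ∀ i, i < t → instanceI n (π i) = y i then
        (hireAt φ (Function.update y t (instanceI n (π t))) t -
          hireAt φ (Function.update y t (instanceI n (π t'))) t) *
          (rho (instanceI n (π t)) - rho (instanceI n (π t')))
      else 0 with hF
  -- Multiplying on the left permutes candidates, here a and b; a prefix of copies of c is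
  -- unaffected.
  have hsum' : 0 ≤ ∑ π, F (Equiv.mulLeft sw π) := by
    rwa [Equiv.sum_comp (Equiv.mulLeft sw) F]
  have hadd := add_nonneg hsum hsum'
  rw [← Finset.sum_add_distrib] at hadd
  refine absurd hadd (not_le.mpr ?_)
  have hpre (π : Equiv.Perm (Fin n)) :
      (∀ i, i < t → instanceI n ((Equiv.mulLeft sw π) i) = y i) ↔
      ∀ i, i < t → instanceI n (π i) = y i := by
    refine forall₂_congr fun i hi => ?_
    rw [hc i hi, Equiv.coe_mulLeft, Equiv.Perm.mul_apply, instanceI_eq_c_iff, instanceI_eq_c_iff]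
    by_cases e0 : (π i : ℕ) = 0
    · simp [sw, e0, swapAB_zero hn e0]
    · by_cases e1 : (π i : ℕ) = 1
      · simp [sw, e1, swapAB_one hn e1]
      · rw [swapAB_other hn e0 e1]
  -- The pairs (a, c) and (b, c) add up to (h(b) - h(a))/2, so h(c) cancels; the pair (a, b) and its
  -- mirror give 2(h(b) - h(a)).
  have hterm (π : Equiv.Perm (Fin n)) (hm : ∀ i, i < t → instanceI n (π i) = y i) :
      F π + F (Equiv.mulLeft sw π) ≤ 0 ∧ ((π t : ℕ) = 0 → F π + F (Equiv.mulLeft sw π) < 0) := by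
    have hne : (π t : ℕ) ≠ π t' := fun e => htt.ne (π.injective (Fin.ext e))
    simp only [hF, hpre, if_pos hm]
    simp only [Equiv.coe_mulLeft, Equiv.Perm.mul_apply]
    have hcase (i : Fin n) :
        ((i : ℕ) = 0 ∧ instanceI n i = (0, 1) ∧ instanceI n (sw i) = (1, 0)) ∨
        ((i : ℕ) = 1 ∧ instanceI n i = (1, 0) ∧ instanceI n (sw i) = (0, 1)) ∨
        ((i : ℕ) ≠ 0 ∧ instanceI n i = (1 / 2, 0) ∧ instanceI n (sw i) = (1 / 2, 0)) := by
      by_cases e0 : (i : ℕ) = 0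
      · exact .inl ⟨e0, instanceI_zero e0, instanceI_one (swapAB_zero hn e0)⟩
      · by_cases e1 : (i : ℕ) = 1
        · exact .inr (.inl ⟨e1, instanceI_one e1, instanceI_zero (swapAB_one hn e1)⟩)
        · exact .inr (.inr ⟨e0, instanceI_other e0 e1,
            by rw [swapAB_other hn e0 e1, instanceI_other e0 e1]⟩)
    rcases hcase (π t) with ⟨p1, p2, p3⟩ | ⟨p1, p2, p3⟩ | ⟨p1, p2, p3⟩ <;>
      rcases hcase (π t') with ⟨q1, q2, q3⟩ | ⟨q1, q2, q3⟩ | ⟨q1, q2, q3⟩ <;>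
      simp only [p2, p3, q2, q3, rho_mk] <;> first
        | exact absurd (p1.trans q1.symm) hne
        | refine ⟨?_, fun hz => ?_⟩ <;> push_cast <;> first
          | linarith
          | exact absurd hz p1
  refine (Finset.sum_lt_sum (g := fun _ => (0 : ℝ)) (fun π _ => ?_)
    ⟨π₀, Finset.mem_univ _, (hterm π₀ hy).2 h0⟩).trans_eq Finset.sum_const_zero
  by_cases hm : ∀ i, i < t → instanceI n (π i) = y i
  · exact (hterm π hm).1
  · simp only [hF, hpre, if_neg hm, add_zero, le_refl]

/-- Replacing the arriving candidate `a` by any other one does not decrease the probability that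
the mechanism hires. -/
theorem hireAt_le_of_agree {n : ℕ} {φ : Mechanism n} (hI : PersuasiveDisclosure φ (instanceI n))
    (hII : PersuasiveDisclosure φ (instanceII n)) {t t' : Fin n} (htt : t < t')
    {π π' : Equiv.Perm (Fin n)} (hagree : ∀ i, i < t → π i = π' i) (h0 : (π t : ℕ) = 0)
    (h0' : (π' t : ℕ) ≠ 0) :
    hireAt φ (instanceI n ∘ π) t ≤ hireAt φ (instanceI n ∘ π') t := by
  have hpi {i : Fin n} (hi : i ≠ t) : (π i : ℕ) ≠ 0 := fun e =>
    hi (π.injective (Fin.ext (e.trans h0.symm)))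
  have e1 : hireAt φ (instanceI n ∘ π) t =
      hireAt φ (Function.update (instanceI n ∘ π) t (0, 1)) t := by
    rw [← instanceI_zero h0]
    exact congrArg (hireAt φ · t) (Function.update_eq_self t (instanceI n ∘ π)).symm
  have e2 : hireAt φ (instanceI n ∘ π') t =
      hireAt φ (Function.update (instanceI n ∘ π) t (instanceI n (π' t))) t := by
    refine hireAt_congr φ fun i hi => ?_
    rcases lt_or_eq_of_le hi with hlt | rfl
    · rw [Function.update_of_ne hlt.ne]
      simp [hagree i hlt]
    · simp
  rw [e1, e2]
  -- Once b is in the prefix, only a and c can still arrive.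
  by_cases hb : ∃ i, i < t ∧ (π i : ℕ) = 1
  · obtain ⟨i, hi, hi1⟩ := hb
    have h1' : (π' t : ℕ) ≠ 1 := fun e => hi.ne (π'.injective (Fin.ext (by
      rw [← hagree i hi, hi1, e])))
    have h1'' : (π t' : ℕ) ≠ 1 := fun e => (hi.trans htt).ne (π.injective (Fin.ext (by
      rw [hi1, e])))
    rw [instanceI_other h0' h1']
    refine hI.hireAt_le_of_two_values htt (by simp) (fun σ hσ r hr => ?_)
      (π₀ := π) (fun _ _ => rfl) (instanceI_zero h0) (instanceI_other (hpi htt.ne') h1'')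
    have hs := hσ i hi
    rw [Function.comp_apply, instanceI_one hi1, instanceI_eq_b_iff] at hs
    by_cases hr0 : (σ r : ℕ) = 0
    · exact .inl (instanceI_zero hr0)
    · exact .inr (instanceI_other hr0 fun e =>
        (hi.trans_le hr).ne (σ.injective (Fin.ext (by rw [hs, e]))))
  · push Not at hb
    have hc (i : Fin n) (hi : i < t) : (instanceI n ∘ π) i = (1 / 2, 0) :=
      instanceI_other (hpi hi.ne) (hb i hi)
    by_cases h1' : (π' t : ℕ) = 1
    · rw [instanceI_one h1']
      exact hireAt_a_le_hireAt_b hI htt hc (fun _ _ => rfl) h0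
    · rw [instanceI_other h0' h1']
      -- A prefix of copies of c also occurs in instance II, where again only a and c can arrive.
      refine hII.hireAt_le_of_two_values htt (by simp) (fun σ _ r _ => ?_)
        (π₀ := π) (fun i hi => ?_) (instanceII_zero h0) (instanceII_other (hpi htt.ne'))
      · by_cases hr0 : (σ r : ℕ) = 0
        · exact .inl (instanceII_zero hr0)
        · exact .inr (instanceII_other hr0)
      · rw [hc i hi, instanceII_other (hpi hi.ne)]

/-! ### The bound 1/n with disclosure -/

theorem sum_xi_instanceI {n : ℕ} (hn : 1 ≤ n) : ∑ i : Fin n, xi (instanceI n i) = 1 := by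
  have (i : Fin n) : xi (instanceI n i) = if i = ⟨0, hn⟩ then 1 else 0 := by
    simp [xi_instanceI, Fin.ext_iff]
  simp [this]

theorem senderUtility_instanceI_le {n : ℕ} (hn : 1 ≤ n) {φ : Mechanism n}
    (hI : PersuasiveDisclosure φ (instanceI n)) (hII : PersuasiveDisclosure φ (instanceII n)) :
    senderUtility φ (instanceI n) ≤ 1 / n := by
  let l : Fin n := ⟨n - 1, by omega⟩
  have hstep (t : Fin n) :
      ∑ π : Equiv.Perm (Fin n), hireAt φ (instanceI n ∘ π) t * xi (instanceI n (π t)) ≤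
      ∑ π : Equiv.Perm (Fin n), hireAt φ (instanceI n ∘ π) t * xi (instanceI n (π l)) := by
    -- This matches each order with a in round t to the one with a moved to the last round `l`.
    rw [← Equiv.sum_comp (Equiv.mulRight (Equiv.swap t l))]
    refine Finset.sum_le_sum fun π _ => ?_
    simp only [Equiv.coe_mulRight, Equiv.Perm.mul_apply, Equiv.swap_apply_left]
    rw [xi_instanceI]
    split_ifs with h0
    · rw [mul_one, mul_one]
      by_cases htl : t = l
      · subst htl
        simp
      · have hlt : t < l := lt_of_le_of_ne (Nat.le_sub_one_of_lt t.2) htl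
        refine hireAt_le_of_agree hI hII hlt (fun i hi => ?_) (by simpa using h0) fun e => ?_
        · simp [Equiv.swap_apply_of_ne_of_ne hi.ne (hi.trans hlt).ne]
        · exact htl (π.injective (Fin.ext (e.trans h0.symm)))
    · simp
  rw [senderUtility, expect_payoff_eq_sum_hireAt]
  rw [← sum_xi_instanceI hn, ← sum_perm_apply (fun i => xi (instanceI n i)) l]
  refine div_le_div_of_nonneg_right ((Finset.sum_le_sum fun t _ => hstep t).trans ?_)
    (Nat.cast_nonneg _)
  rw [Finset.sum_comm]
  refine Finset.sum_le_sum fun π _ => ?_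
  rw [← Finset.sum_mul]
  exact mul_le_of_le_one_left (NNReal.coe_nonneg _) (sum_hireAt_le_one _ _)

/-- Only a has positive ξ, and its value is 1, so ξ is the indicator of the sender's best candidate.
-/
theorem successProb_instanceI {n : ℕ} (hn : 1 ≤ n) (φ : Mechanism n) :
    successProb φ (instanceI n) = senderUtility φ (instanceI n) := by
  refine le_antisymm (expect_mono φ _ fun π s => ?_) (expect_mono φ _ fun π s => ?_)
  all_goals
    refine (payoff_congr 0 s fun r => ?_).le
    have h : (∀ j, xi (instanceI n j) ≤ xi ((instanceI n ∘ π) r)) ↔ (π r : ℕ) = 0 := by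
      simp only [Function.comp_apply, xi_instanceI]
      constructor
      · intro h
        by_contra h0
        have := h ⟨0, hn⟩
        simp only [h0, if_true, if_false] at this
        linarith
      · intro h0 j
        rw [if_pos h0]
        split_ifs <;> norm_num
    simp only [h]
    simp [xi_instanceI]

theorem expect_first {n : ℕ} (hn : 0 < n) (φ : Mechanism n) (θ : Instance n)
    (u : Candidate → ℝ) :
    expect φ θ (fun x _ => u (x ⟨0, hn⟩)) = (∑ i, u (θ i)) / n := by
  rw [expect_of_forall_eq φ θ fun x => u (x ⟨0, hn⟩)]
  exact sum_perm_apply (fun i => u (θ i)) ⟨0, hn⟩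

theorem signalProb_hireFirst {n : ℕ} (x : Fin n → Candidate) (s : Fin n → Bool) :
    signalProb (hireFirst n) x s = if s = fun _ => true then 1 else 0 := by
  simp [signalProb, hireFirst, Finset.prod_ite_zero, funext_iff]

theorem senderUtility_hireFirst {n : ℕ} (hn : 1 ≤ n) :
    senderUtility (hireFirst n) (instanceI n) = 1 / n := by
  rw [← sum_xi_instanceI hn, ← expect_first hn (hireFirst n)]
  simp only [senderUtility, expect, signalProb_hireFirst, ite_mul, one_mul, zero_mul,
    Finset.sum_ite_eq', Finset.mem_univ, if_true]
  congr 1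
  refine Finset.sum_congr rfl fun π _ => ?_
  exact payoff_eq_of_first xi _ le_rfl rfl fun q _ hq => absurd hq (Nat.not_lt_zero _)

theorem senderUtility_instanceI_le_one {n : ℕ} (φ : Mechanism n) :
    senderUtility φ (instanceI n) ≤ 1 := by
  rw [← expect_one φ (instanceI n)]
  refine expect_mono φ _ fun π s => ?_
  have h := payoff_add_payoff_le_one (u := xi) (v := fun _ => 0) 0 s (x := instanceI n ∘ π)
    (y := instanceI n ∘ π) fun r => by
      rw [Function.comp_apply, xi_instanceI]
      split_ifs <;> norm_num
  have h0 : payoff (fun _ => 0) 0 s (instanceI n ∘ π) = 0 := by simp [payoff]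
  linarith

/-! ### Upper bound in the benchmark -/

theorem benchmarkSuccesses_instanceI {n : ℕ} (hn : 1 ≤ n) :
    benchmarkSuccesses (instanceI n) = benchmarkUtilities (instanceI n) := by
  simp only [benchmarkSuccesses, benchmarkUtilities, successProb_instanceI hn]

theorem sum_rho_instanceI {n : ℕ} (hn : 2 ≤ n) : ∑ i : Fin n, rho (instanceI n i) = n / 2 := by
  have (i : Fin n) : rho (instanceI n i) =
      1 / 2 + (if i = ⟨1, hn⟩ then 1 / 2 else 0) - (if i = ⟨0, by omega⟩ then 1 / 2 else 0) := by
    rw [rho_instanceI]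
    simp only [Fin.ext_iff]
    split_ifs <;> first | omega | norm_num
  simp only [this, Finset.sum_sub_distrib, Finset.sum_add_distrib, Finset.sum_ite_eq',
    Finset.mem_univ, if_true]
  simp
  ring

/-- A mechanism that is persuasive without disclosure gives the receiver at least her utility from
hiring in round 1. -/
theorem PersuasiveNoDisclosure.sum_rho_div_le {n : ℕ} (hn : 0 < n) {φ : Mechanism n}
    {θ : Instance n} (h : PersuasiveNoDisclosure φ θ) :
    (∑ i, rho (θ i)) / n ≤ expect φ θ (fun x s => payoff rho 0 s x) := by
  -- The two possible first signals cover all outcomes; the deviation hires in round 1 after either.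
  have h1 := add_le_add (h ⟨0, hn⟩ true fun _ _ => true) (h ⟨0, hn⟩ false fun _ _ => true)
  rw [← expect_add, ← expect_add, ← expect_first hn φ] at *
  refine (expect_mono φ θ fun π s => ?_).trans (h1.trans (expect_mono φ θ fun π s => ?_))
  · have hp : payoff rho 0 (fun _ => true) (θ ∘ π) = rho ((θ ∘ π) ⟨0, hn⟩) :=
      payoff_eq_of_first rho _ le_rfl rfl fun q _ hq => absurd hq (Nat.not_lt_zero _)
    have hl (i : Fin n) : ¬ i < ⟨0, hn⟩ := Nat.not_lt_zero _
    cases s ⟨0, hn⟩ <;> simp [hl, hp]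
  · have hl (i : Fin n) : ¬ i < ⟨0, hn⟩ := Nat.not_lt_zero _
    cases s ⟨0, hn⟩ <;> simp [hl]

theorem PersuasiveNoDisclosure.senderUtility_instanceI_le {n : ℕ} (hn : 2 ≤ n) {φ : Mechanism n}
    (h : PersuasiveNoDisclosure φ (instanceI n)) : senderUtility φ (instanceI n) ≤ 1 / 2 := by
  have h1 := h.sum_rho_div_le (by omega)
  have h2 : expect φ (instanceI n) (fun x s => payoff rho 0 s x) +
      senderUtility φ (instanceI n) ≤ 1 := by
    rw [senderUtility, ← expect_add, ← expect_one φ (instanceI n)]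
    refine expect_mono φ _ fun π s => payoff_add_payoff_le_one 0 s fun r => ?_
    simp only [Function.comp_apply, rho_instanceI, xi_instanceI]
    split_ifs <;> norm_num
  have hn' : (n : ℝ) ≠ 0 := by positivity
  rw [sum_rho_instanceI hn, div_div_cancel_left' hn'] at h1
  linarith

/-! ### A benchmark mechanism attaining 1/2 -/

open Classical in
/-- The mechanism that signals HIRE exactly upon the candidates `a` and `b` of instance I. -/
def hireAB (n : ℕ) : Mechanism n :=
  ⟨fun t x _ => if x ⟨t, Set.mem_Iic.mpr le_rfl⟩ = (1 / 2, 0) then 0 else 1⟩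

open Classical in
theorem signalProb_hireAB {n : ℕ} (x : Fin n → Candidate) (s : Fin n → Bool) :
    signalProb (hireAB n) x s = if ∀ t, s t = true ↔ x t ≠ (1 / 2, 0) then 1 else 0 := by
  have (t : Fin n) : signalFactor (hireAB n) x s t =
      if s t = true ↔ x t ≠ (1 / 2, 0) then 1 else 0 := by
    simp only [signalFactor, hireAB, ne_eq]
    by_cases hc : x t = (1 / 2, 0)
    · cases s t <;> simp [hc]
    · simp only [hc, if_false]
      cases s t <;> simp
  simp only [signalProb_eq_prod, this, Finset.prod_ite_zero, Finset.prod_const_one]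
  simp

/-- Comparison of expectations under `hireAB`, averaged over the exchange of `a` and `b`. -/
theorem expect_hireAB_mono {n : ℕ} (hn : 1 < n) {f g : (Fin n → Candidate) → (Fin n → Bool) → ℝ}
    (h : ∀ (π : Equiv.Perm (Fin n)) (s : Fin n → Bool),
      (∀ t, s t = true ↔ (π t : ℕ) = 0 ∨ (π t : ℕ) = 1) →
      f (instanceI n ∘ π) s + f (instanceI n ∘ (swapAB hn * π : Equiv.Perm (Fin n))) s ≤
      g (instanceI n ∘ π) s + g (instanceI n ∘ (swapAB hn * π : Equiv.Perm (Fin n))) s) :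
    expect (hireAB n) (instanceI n) f ≤ expect (hireAB n) (instanceI n) g := by
  classical
  have hne (i : Fin n) : instanceI n i ≠ (1 / 2, 0) ↔ (i : ℕ) = 0 ∨ (i : ℕ) = 1 := by
    rw [ne_eq, instanceI_eq_c_iff]
    omega
  have hsw (i : Fin n) : (swapAB hn i : ℕ) = 0 ∨ (swapAB hn i : ℕ) = 1 ↔
      (i : ℕ) = 0 ∨ (i : ℕ) = 1 := by
    by_cases h0 : (i : ℕ) = 0
    · simp [h0, swapAB_zero hn h0]
    · by_cases h1 : (i : ℕ) = 1
      · simp [h1, swapAB_one hn h1]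
      · rw [swapAB_other hn h0 h1]
  have hdouble (f : (Fin n → Candidate) → (Fin n → Bool) → ℝ) :
      expect (hireAB n) (instanceI n) f + expect (hireAB n) (instanceI n) f =
      (∑ π : Equiv.Perm (Fin n), ∑ s : Fin n → Bool,
        if ∀ t, s t = true ↔ (π t : ℕ) = 0 ∨ (π t : ℕ) = 1 then
          f (instanceI n ∘ π) s + f (instanceI n ∘ (swapAB hn * π : Equiv.Perm (Fin n))) s
        else 0) / (n.factorial : ℝ) := by
    rw [expect, ← add_div]
    congr 1
    -- Exchanging a and b leaves the signals of `hireAB` unchanged.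
    nth_rewrite 2 [← Equiv.sum_comp (Equiv.mulLeft (swapAB hn))]
    simp only [← Finset.sum_add_distrib, signalProb_hireAB]
    refine Finset.sum_congr rfl fun π _ => Finset.sum_congr rfl fun s _ => ?_
    simp only [Function.comp_apply, Equiv.coe_mulLeft, Equiv.Perm.mul_apply, hne, hsw]
    split_ifs <;> simp
  have key : expect (hireAB n) (instanceI n) f + expect (hireAB n) (instanceI n) f ≤
      expect (hireAB n) (instanceI n) g + expect (hireAB n) (instanceI n) g := by
    rw [hdouble, hdouble]
    gcongr with π _ s _
    split_ifs with hs
    · exact h π s hs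
    · exact le_rfl
  linarith

/-- The receiver sees signals only, so her decisions agree on an order and its a-b exchange. Any
hire yields total ρ equal to 1 over the two, and obedience always hires. -/
theorem persuasiveNoDisclosure_hireAB {n : ℕ} (hn : 1 < n) :
    PersuasiveNoDisclosure (hireAB n) (instanceI n) := by
  intro t b τ
  refine expect_hireAB_mono hn fun π s hs => ?_
  have hrho (r : Fin n) : rho ((instanceI n ∘ π) r) +
      rho ((instanceI n ∘ (swapAB hn * π : Equiv.Perm (Fin n))) r) = 1 := by
    simp only [Function.comp_apply, Equiv.Perm.mul_apply]
    by_cases h0 : (π r : ℕ) = 0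
    · rw [instanceI_zero h0, instanceI_one (swapAB_zero hn h0)]
      simp
    · by_cases h1 : (π r : ℕ) = 1
      · rw [instanceI_one h1, instanceI_zero (swapAB_one hn h1)]
        simp
      · rw [swapAB_other hn h0 h1, instanceI_other h0 h1]
        norm_num
  split_ifs with hev
  · refine (payoff_add_payoff_le_one _ _ fun r => (hrho r).le).trans ?_
    rcases exists_first_or_forall_false t s with ⟨r, h1, h2, h3⟩ | h0
    · rw [payoff_eq_of_first rho _ h1 h2 h3, payoff_eq_of_first rho _ h1 h2 h3, hrho]
    -- The round of a carries HIRE, so the signals cannot all be NOT.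
    · have hz : s (π.symm ⟨0, by omega⟩) = true := (hs _).mpr (.inl (by simp))
      rcases lt_or_ge (π.symm ⟨0, by omega⟩) t with hlt | hge
      · simp [hev.1 _ hlt] at hz
      · simp [h0 _ hge] at hz
  · exact le_rfl

theorem senderUtility_hireAB {n : ℕ} (hn : 1 < n) :
    senderUtility (hireAB n) (instanceI n) = 1 / 2 := by
  have hhalf : expect (hireAB n) (instanceI n) (fun _ _ => 1 / 2) = 1 / 2 := by
    have h := expect_add (hireAB n) (instanceI n) (fun _ _ => 1 / 2) (fun _ _ => 1 / 2)
    have h1 := expect_one (hireAB n) (instanceI n)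
    norm_num at h
    linarith
  have key (π : Equiv.Perm (Fin n)) (s : Fin n → Bool)
      (hs : ∀ t, s t = true ↔ (π t : ℕ) = 0 ∨ (π t : ℕ) = 1) :
      payoff xi 0 s (instanceI n ∘ π) +
        payoff xi 0 s (instanceI n ∘ (swapAB hn * π : Equiv.Perm (Fin n))) = 1 / 2 + 1 / 2 := by
    rcases exists_first_or_forall_false 0 s with ⟨r, h1, h2, h3⟩ | h0
    · rw [payoff_eq_of_first xi _ h1 h2 h3, payoff_eq_of_first xi _ h1 h2 h3]
      simp only [Function.comp_apply, Equiv.Perm.mul_apply]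
      rcases (hs r).mp h2 with h0 | h1
      · rw [instanceI_zero h0, instanceI_one (swapAB_zero hn h0)]
        norm_num
      · rw [instanceI_one h1, instanceI_zero (swapAB_one hn h1)]
        norm_num
    · have hz : s (π.symm ⟨0, by omega⟩) = true := (hs _).mpr (.inl (by simp))
      simp [h0 _ (Nat.zero_le _)] at hz
  rw [← hhalf]
  exact le_antisymm (expect_hireAB_mono hn fun π s hs => (key π s hs).le)
    (expect_hireAB_mono hn fun π s hs => (key π s hs).ge)

theorem isGreatest_benchmarkUtilities_instanceI {n : ℕ} (hn : 2 ≤ n) :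
    IsGreatest (benchmarkUtilities (instanceI n)) (1 / 2) := by
  refine ⟨⟨hireAB n, persuasiveNoDisclosure_hireAB hn, (senderUtility_hireAB hn).symm⟩, ?_⟩
  rintro v ⟨φ, hφ, rfl⟩
  exact hφ.senderUtility_instanceI_le hn

/-- With a alone every payoff of the receiver is 0, so obedience is optimal. -/
theorem isGreatest_benchmarkUtilities_instanceI_one :
    IsGreatest (benchmarkUtilities (instanceI 1)) 1 := by
  refine ⟨⟨hireFirst 1, fun t b τ => ?_, ?_⟩, ?_⟩
  · have hp (k : ℕ) (d : Fin 1 → Bool) (π : Equiv.Perm (Fin 1)) :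
        payoff rho k d (instanceI 1 ∘ π) = 0 := by
      refine Finset.sum_eq_zero fun r _ => ?_
      simp [rho_instanceI]
    exact expect_mono _ _ fun π s => by simp [hp]
  · simp [senderUtility_hireFirst le_rfl]
  · rintro v ⟨φ, -, rfl⟩
    exact senderUtility_instanceI_le_one φ

end

end OnlinePersuasion

open OnlinePersuasion
theorem mainTheorem5 :
    (∀ n : ℕ, 1 ≤ n → ∃ θ : Instance n,
      0 < optSuccess θ ∧ 0 < optUtility θ ∧
      ∀ φ : Mechanism n, SecretaryPersuasive φ →
        successProb φ θ ≤ 2 / (n : ℝ) * optSuccess θ ∧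
        senderUtility φ θ ≤ 2 / (n : ℝ) * optUtility θ) ∧
    (∀ n : ℕ, 2 ≤ n →
      IsGreatest (benchmarkSuccesses (instanceI n)) (1 / 2) ∧
      IsGreatest (benchmarkUtilities (instanceI n)) (1 / 2) ∧
      successProb (hireFirst n) (instanceI n) = 1 / (n : ℝ) ∧
      senderUtility (hireFirst n) (instanceI n) = 1 / (n : ℝ) ∧
      ∀ φ : Mechanism n,
        PersuasiveDisclosure φ (instanceI n) → PersuasiveDisclosure φ (instanceII n) →
          successProb φ (instanceI n) ≤ 2 / (n : ℝ) * optSuccess (instanceI n) ∧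
          senderUtility φ (instanceI n) ≤ 2 / (n : ℝ) * optUtility (instanceI n) ∧
          successProb φ (instanceI n) ≤ successProb (hireFirst n) (instanceI n) ∧
          senderUtility φ (instanceI n) ≤ senderUtility (hireFirst n) (instanceI n)) := by
  have hopt {n : ℕ} (hn : 1 ≤ n) : optSuccess (instanceI n) = optUtility (instanceI n) := by
    rw [optSuccess, benchmarkSuccesses_instanceI hn, optUtility]
  have hutil {n : ℕ} (hn : 2 ≤ n) : optUtility (instanceI n) = 1 / 2 :=
    (isGreatest_benchmarkUtilities_instanceI hn).csSup_eq
  refine ⟨fun n hn => ⟨instanceI n, ?_⟩, fun n hn => ?_⟩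
  · simp only [hopt hn, successProb_instanceI hn, and_self]
    rcases hn.eq_or_lt with rfl | hn2
    · have h1 : optUtility (instanceI 1) = 1 :=
        isGreatest_benchmarkUtilities_instanceI_one.csSup_eq
      rw [h1]
      refine ⟨one_pos, one_pos, fun φ _ => ?_⟩
      have := senderUtility_instanceI_le_one φ
      norm_num
      linarith
    · rw [hutil hn2]
      refine ⟨by norm_num, by norm_num, fun φ hφ => ?_⟩
      refine (senderUtility_instanceI_le hn (hφ _) (hφ _)).trans_eq ?_
      ring
  · have hn1 : 1 ≤ n := by omega
    simp only [hopt hn1, successProb_instanceI hn1, benchmarkSuccesses_instanceI hn1,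
      senderUtility_hireFirst hn1, hutil hn]
    refine ⟨isGreatest_benchmarkUtilities_instanceI hn,
      isGreatest_benchmarkUtilities_instanceI hn, trivial, trivial, fun φ hI hII => ?_⟩
    have h := senderUtility_instanceI_le hn1 hI hII
    have e : 2 / (n : ℝ) * (1 / 2) = 1 / n := by ring
    rw [e]
    exact ⟨h, h, h, h⟩
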